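/- The term $a_n$ of an integer sequence $A=(a_n)_{n\ge 1}$ is said to have a primitive prime divisor if there is a prime $p$ with $p\mid a_n$ and $p\nmid a_m$ for every $1\le m<n$ with $a_m\ne 0$. The Zsigmondy bound of $A$ is $$Z(A)=\max\{n\ge 1: a_n \text{ does not have a primitive prime divisor}\}$$ if this set is finite (with $Z(A)=0$ if it is empty), and $Z(A)=\infty$ otherwise. For a real quadratic field $K$ with ring of integers $R$ and a unit $\alpha\in R\setminus\{\pm1\}$, let $\Delta=(\Delta_n)_{n\ge1}$ be the integer sequence $\Delta_n=N_{K/\mathbb{Q}}(\alpha^n-1)$. **Corollary 1.3.** 1. There exists a positive integer $C_1$ such that for every real quadratic field $K$ and every unit $\alpha\in R\setminus\{\pm1\}$ with $N_{K/\mathbb{Q}}(\alpha)=1$, we have $Z(\Delta)\le C_1$. 2. There exists a positive integer $C_2$ such that for every real quadratic field $K$ and every unit $\alpha\in R\setminus\{\pm1\}$ with $N_{K/\mathbb{Q}}(\alpha)=-1$, the term $\Delta_n$ has a primitive prime divisor for every $n>C_2$ with $n\not\equiv 2\pmod 4$. -/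

import Mathlib

open scoped NumberField

/-- The term `a n` of an integer sequence `(a n)_{n ≥ 1}` has a primitive prime divisor: some prime
divides `a n` and divides no nonzero term `a m` with `1 ≤ m < n`.
Sequences are functions on `ℕ` of which only the values at `n ≥ 1` are used. -/
def HasPrimitivePrimeDivisor (a : ℕ → ℤ) (n : ℕ) : Prop :=
  ∃ p : ℕ, p.Prime ∧ (p : ℤ) ∣ a n ∧
    ∀ m : ℕ, 1 ≤ m → m < n → a m ≠ 0 → ¬ (p : ℤ) ∣ a m

/-- The indices `n ≥ 1` whose term has no primitive prime divisor. -/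
def nonPrimitiveIndices (a : ℕ → ℤ) : Set ℕ :=
  {n : ℕ | 1 ≤ n ∧ ¬ HasPrimitivePrimeDivisor a n}

open Classical in
/-- The Zsigmondy bound `Z(a)`: the largest `n ≥ 1` such that `a n` has no primitive prime divisor
if there are finitely many such `n` (and `0` if there are none), and `∞` otherwise. -/
noncomputable def zsigmondyBound (a : ℕ → ℤ) : ℕ∞ :=
  if h : (nonPrimitiveIndices a).Finite then ((h.toFinset.sup id : ℕ) : ℕ∞) else ⊤

/-- A real quadratic field: a quadratic extension of `ℚ` that embeds in `ℝ`. -/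
def IsRealQuadraticField (K : Type*) [Field K] [NumberField K] : Prop :=
  Module.finrank ℚ K = 2 ∧ Nonempty (K →+* ℝ)

/-- The Lehmer–Pierce sequence `Δ n = N (α ^ n - 1)` of an algebraic integer `α` of `K`, where `N` is
the norm from `K` to `ℚ`, which is integer-valued on the ring of integers. -/
noncomputable def lehmerPierce {K : Type*} [Field K] [NumberField K] (α : 𝓞 K) (n : ℕ) : ℤ :=
  Algebra.norm ℤ (α ^ n - 1)

/-- `lehmerPierce` is indeed given by the field norm of `K / ℚ`. -/
theorem lehmerPierce_cast {K : Type*} [Field K] [NumberField K] (α : 𝓞 K) (n : ℕ) :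
    (lehmerPierce α n : ℚ) = Algebra.norm ℚ ((α : K) ^ n - 1) := by
  simp [lehmerPierce, Algebra.coe_norm_int]

/-!
Write `Φ` for the `n`-th cyclotomic polynomial, so that `N (Φ α)` divides `N (α ^ n - 1)`. A prime
`p` dividing `N (Φ α)` that is not primitive divides `n`, because the order of `α` modulo a prime
above `p` is the prime-to-`p` part of `n`. Its exponent in `N (Φ α)` is then at most `2`, because
`Φ α` divides `∑ i < p, β ^ i` for `β = α ^ (n / p)`, which is close to `1` at `p`. So if `n` has
no primitive prime divisor then `|N (Φ α)| ≤ n ^ 2`. On the other hand `N (Φ α)` is, up to sign, the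
product of `ζ ^ 2 - t * ζ + N α` over the primitive `n`-th roots of unity `ζ`, with `t` the trace of
`α`, and comparing with `Φ 1` and `Φ (-1)` gives `|N (Φ α)| ^ 2 ≥ 2 ^ φ(n)`. As `n ≤ 2 * φ(n) ^ 2`,
this is impossible for large `n`.
-/

open Polynomial

theorem dvd_sq_of_forall_prime_dvd {a : ℤ} {n : ℕ}
    (h : ∀ p : ℕ, p.Prime → (p : ℤ) ∣ a → p ∣ n ∧ ¬ (p : ℤ) ^ 3 ∣ a) : a ∣ (n : ℤ) ^ 2 := by
  rw [← Int.natCast_pow, ← Int.natAbs_dvd_natAbs, Int.natAbs_natCast, Nat.dvd_iff_prime_pow_dvd_dvd]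
  intro p k hp hk
  replace hk : (p : ℤ) ^ k ∣ a := by exact_mod_cast Int.natCast_dvd.mpr hk
  rcases eq_or_ne k 0 with rfl | hk0
  · simp
  obtain ⟨hpn, hcube⟩ := h p hp ((dvd_pow_self _ hk0).trans hk)
  have hk2 : k ≤ 2 := by
    by_contra! hk3
    exact hcube ((pow_dvd_pow _ hk3).trans hk)
  exact (pow_dvd_pow p hk2).trans (pow_dvd_pow_of_dvd hpn 2)

section CyclotomicEval

variable {R : Type*} [CommRing R]

theorem cyclotomic_eval_dvd_pow_sub_one (n : ℕ) (α : R) :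
    (cyclotomic n R).eval α ∣ α ^ n - 1 := by
  simpa using eval_dvd (x := α) (cyclotomic.dvd_X_pow_sub_one n R)

theorem cyclotomic_eval_dvd_geom_sum {n p : ℕ} (hn : n ≠ 0) (hp : 1 < p) (hpn : p ∣ n) (α : R) :
    (cyclotomic n R).eval α ∣ ∑ i ∈ Finset.range p, (α ^ (n / p)) ^ i := by
  have hproper : n / p ∈ n.properDivisors :=
    Nat.mem_properDivisors.mpr ⟨Nat.div_dvd_of_dvd hpn, Nat.div_lt_self (by omega) hp⟩
  have hpos : n / p ≠ 0 := (Nat.div_pos (Nat.le_of_dvd (by omega) hpn) (by omega)).ne'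
  have hfactor : (X : R[X]) ^ n - 1 =
      (X ^ (n / p) - 1) * ∑ i ∈ Finset.range p, (X ^ (n / p)) ^ i := by
    rw [mul_geom_sum, ← pow_mul, Nat.div_mul_cancel hpn]
  obtain ⟨q, hq⟩ := X_pow_sub_one_mul_cyclotomic_dvd_X_pow_sub_one_of_dvd R hproper
  rw [hfactor, mul_assoc] at hq
  have hdvd : cyclotomic n R ∣ ∑ i ∈ Finset.range p, (X ^ (n / p)) ^ i :=
    ⟨q, (monic_X_pow_sub_C (1 : R) hpos).isRegular.left (by simpa using hq)⟩
  simpa [eval_finsetSum] using eval_dvd (x := α) hdvd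

theorem geom_sum_dvd_geom_sum_sq {p : ℕ} (hp : p.Prime) (hp2 : p ≠ 2) (β : R) :
    ∑ i ∈ Finset.range p, β ^ i ∣ ∑ i ∈ Finset.range p, (β ^ 2) ^ i := by
  have := Fact.mk hp
  have h2p : ¬ 2 ∣ p := fun h => hp2 ((Nat.prime_dvd_prime_iff_eq Nat.prime_two hp).mp h).symm
  have h := congrArg (eval β) (cyclotomic_expand_eq_cyclotomic_mul Nat.prime_two h2p R)
  rw [expand_eval, eval_mul, cyclotomic_prime] at h
  simp only [eval_finsetSum, eval_pow, eval_X] at h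
  exact Dvd.intro_left _ h.symm

theorem exists_geom_sum_one_add_eq {p : ℕ} (hp : p.Prime) (hp2 : p ≠ 2) (u : R) :
    ∃ w, ∑ i ∈ Finset.range p, (1 + u) ^ i = p * (1 + u * w) + u ^ (p - 1) := by
  obtain ⟨q, rfl⟩ : ∃ q, p = q + 2 := ⟨p - 2, by have := hp.two_le; omega⟩
  have hexpand := congrArg (eval u) (geom_sum_X_comp_X_add_one_eq_sum (R := R) (q + 2))
  simp only [eval_comp, eval_finsetSum, eval_pow, eval_X, eval_add, eval_one, eval_mul,
    eval_natCast] at hexpand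
  have hmiddle : ∀ k ∈ Finset.range q, ((q + 2 : ℕ) : R) * u ∣
      (((q + 2).choose (k + 1 + 1) : ℕ) : R) * u ^ (k + 1) := by
    intro k hk
    rw [Finset.mem_range] at hk
    exact mul_dvd_mul (Nat.cast_dvd_cast (hp.dvd_choose_self (by omega) (by omega)))
      (dvd_pow_self u k.succ_ne_zero)
  obtain ⟨w, hw⟩ := Finset.dvd_sum hmiddle
  refine ⟨w, ?_⟩
  rw [add_comm 1 u, hexpand, Finset.sum_range_succ, Finset.sum_range_succ', hw]
  simp only [Nat.choose_self, Nat.choose_one_right, zero_add,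
    show q + 2 - 1 = q + 1 by omega]
  push_cast
  ring

theorem exists_geom_sum_eq_prime_mul {p : ℕ} (hp : p.Prime) (hp2 : p ≠ 2) {β : R}
    (h : (p : R) ^ 2 ∣ (β - 1) ^ (p - 1)) :
    ∃ w z, ∑ i ∈ Finset.range p, β ^ i = p * (1 + (β - 1) * w + p * z) := by
  obtain ⟨w, hw⟩ := exists_geom_sum_one_add_eq hp hp2 (β - 1)
  obtain ⟨z, hz⟩ := h
  refine ⟨w, z, ?_⟩
  rw [add_sub_cancel] at hw
  rw [hw, hz]
  ring

end CyclotomicEval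

theorem exists_isPrimitiveRoot_of_isRoot_cyclotomic {A : Type*} [CommRing A] [IsDomain A] {p : ℕ}
    [Fact p.Prime] [CharP A p] {n : ℕ} (hn : n ≠ 0) {a : A}
    (ha : (cyclotomic n A).IsRoot a) :
    ∃ j r, n = p ^ j * r ∧ ¬ p ∣ r ∧ IsPrimitiveRoot a r := by
  obtain ⟨j, r, hr, rfl⟩ := Nat.exists_eq_pow_mul_and_not_dvd hn p (Fact.out : p.Prime).ne_one
  have : NeZero (r : A) := ⟨fun h => hr ((CharP.cast_eq_zero_iff A p r).mp h)⟩
  exact ⟨j, r, rfl, hr, isRoot_cyclotomic_prime_pow_mul_iff_of_charP.mp ha⟩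

theorem dvd_of_isPrimitiveRoot_of_pow_eq_neg_one_pow {A : Type*} [CommRing A] {a : A} {r m : ℕ}
    (ha : IsPrimitiveRoot a r) (h : a ^ m = (-1) ^ m) (hr : ¬ r ≡ 2 [MOD 4]) : r ∣ m := by
  rcases Nat.even_or_odd m with hm | hm
  · exact ha.dvd_of_pow_eq_one m (by rw [h, hm.neg_one_pow])
  have hdvd : r ∣ m * 2 := ha.dvd_of_pow_eq_one _ (by rw [pow_mul, h, hm.neg_one_pow, neg_one_sq])
  have hodd : Odd r := by
    by_contra hr_even
    have h4 : 4 ∣ r := by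
      rw [Nat.not_odd_iff] at hr_even
      unfold Nat.ModEq at hr
      omega
    have := h4.trans hdvd
    rw [Nat.odd_iff] at hm
    omega
  exact (Nat.coprime_two_right.mpr hodd).dvd_of_dvd_mul_right hdvd

theorem pow_div_eq_one_or_eq_neg_one {e : ℤ} {n p : ℕ} (he : e = 1 ∨ e = -1 ∧ ¬ n ≡ 2 [MOD 4])
    (hpn : p ∣ n) : e ^ (n / p) = 1 ∨ e ^ (n / p) = -1 ∧ p ≠ 2 := by
  rcases he with rfl | ⟨rfl, hmod⟩
  · simp
  rcases eq_or_ne p 2 with rfl | hp2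
  · refine Or.inl (Even.neg_one_pow ?_)
    rw [Nat.even_iff]
    unfold Nat.ModEq at hmod
    omega
  · exact (neg_one_pow_eq_or ℤ _).imp_right fun h => ⟨h, hp2⟩

theorem prime_pow_le_totient_sq {p : ℕ} (hp : p.Prime) (hp2 : p ≠ 2) (k : ℕ) :
    p ^ k ≤ (p ^ k).totient ^ 2 := by
  rcases k with _ | k
  · simp
  have hp3 : 3 ≤ p := hp.two_le.lt_of_ne' hp2
  have hbase : p ≤ (p - 1) ^ 2 := by
    obtain ⟨q, rfl⟩ := Nat.exists_eq_add_of_le' hp3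
    rw [show q + 3 - 1 = q + 2 by omega]
    nlinarith
  calc p ^ (k + 1) = p ^ k * p := pow_succ p k
    _ ≤ (p ^ k) ^ 2 * (p - 1) ^ 2 :=
        Nat.mul_le_mul (Nat.le_self_pow two_ne_zero _) hbase
    _ = (p ^ (k + 1)).totient ^ 2 := by rw [Nat.totient_prime_pow_succ hp, mul_pow]

theorem le_totient_sq_of_odd {n : ℕ} (hn : Odd n) : n ≤ n.totient ^ 2 := by
  induction n using Nat.recOnPosPrimePosCoprime with
  | zero => simp
  | one => simp
  | prime_pow p k hp hk =>
    refine prime_pow_le_totient_sq hp ?_ k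
    rintro rfl
    exact absurd ((Nat.odd_pow_iff hk.ne').mp hn) (by decide)
  | coprime a b _ _ hab iha ihb =>
    obtain ⟨ha, hb⟩ := Nat.odd_mul.mp hn
    rw [Nat.totient_mul hab, mul_pow]
    exact Nat.mul_le_mul (iha ha) (ihb hb)

theorem le_two_mul_totient_sq (n : ℕ) : n ≤ 2 * n.totient ^ 2 := by
  rcases eq_or_ne n 0 with rfl | hn
  · simp
  obtain ⟨k, m, hm, rfl⟩ := Nat.exists_eq_two_pow_mul_odd hn
  have hpow : 2 ^ k ≤ 2 * (2 ^ k).totient ^ 2 := by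
    rcases k with _ | k
    · simp
    rw [Nat.totient_prime_pow_succ Nat.prime_two, pow_succ']
    simpa using Nat.le_self_pow two_ne_zero (2 ^ k)
  have hcop : (2 ^ k).Coprime m := (Nat.coprime_two_left.mpr hm).pow_left k
  calc 2 ^ k * m ≤ 2 * (2 ^ k).totient ^ 2 * m.totient ^ 2 :=
        Nat.mul_le_mul hpow (le_totient_sq_of_odd hm)
    _ = 2 * (2 ^ k * m).totient ^ 2 := by rw [Nat.totient_mul hcop, mul_pow, mul_assoc]

theorem sixteen_mul_pow_eight_lt_two_pow {k : ℕ} (hk : 64 ≤ k) : 16 * k ^ 8 < 2 ^ k := by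
  induction k, hk using Nat.le_induction with
  | base => norm_num
  | succ k hk ih =>
    have h : (64 * (k + 1)) ^ 8 ≤ (65 * k) ^ 8 := Nat.pow_le_pow_left (by omega) 8
    rw [mul_pow, mul_pow] at h
    rw [pow_succ 2 k]
    omega

theorem pow_four_lt_two_pow_totient {n : ℕ} (hn : 8192 < n) : n ^ 4 < 2 ^ n.totient := by
  have hle := le_two_mul_totient_sq n
  have hφ : 64 ≤ n.totient := by
    by_contra! hlt
    nlinarith
  calc n ^ 4 ≤ (2 * n.totient ^ 2) ^ 4 := Nat.pow_le_pow_left hle 4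
    _ = 16 * n.totient ^ 8 := by ring
    _ < 2 ^ n.totient := sixteen_mul_pow_eight_lt_two_pow hφ

theorem eval_cyclotomic_eq_prod_sub_primitiveRoots {n : ℕ} (hn : n ≠ 0) (x : ℂ) :
    (cyclotomic n ℂ).eval x = ∏ ζ ∈ primitiveRoots n ℂ, (x - ζ) := by
  rw [cyclotomic_eq_prod_X_sub_primitiveRoots (Complex.isPrimitiveRoot_exp n hn), eval_prod]
  simp

theorem one_le_prod_norm_sub_primitiveRoots {n : ℕ} (hn : 3 ≤ n) {d : ℤ} (hd : d ^ 2 = 1) :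
    1 ≤ ∏ ζ ∈ primitiveRoots n ℂ, ‖(d : ℂ) - ζ‖ := by
  have hne : (cyclotomic n ℤ).eval d ≠ 0 := by
    intro h
    have : NeZero (n : ℤ) := ⟨by positivity⟩
    have hroot : IsPrimitiveRoot d n := isRoot_cyclotomic_iff.mp h
    have := Nat.le_of_dvd two_pos (hroot.dvd_of_pow_eq_one 2 hd)
    omega
  rw [← norm_prod, ← eval_cyclotomic_eq_prod_sub_primitiveRoots (by omega), ← map_cyclotomic_int,
    eval_intCast_map, eq_intCast, Complex.norm_intCast]
  exact_mod_cast Int.one_le_abs hne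

theorem mul_conj_eq_one_of_norm_eq_one {z : ℂ} (hz : ‖z‖ = 1) : z * starRingEnd ℂ z = 1 := by
  simp [Complex.mul_conj', hz]

theorem two_mul_norm_sub_le {z : ℂ} (hz : ‖z‖ = 1) {s d : ℝ} (hd : d ^ 2 = 1) (hs : 3 ≤ d * s) :
    2 * ‖d - z‖ ≤ ‖z ^ 2 - s * z + 1‖ := by
  have hconj := mul_conj_eq_one_of_norm_eq_one hz
  have hsub : ‖d - z‖ ^ 2 = 2 - d * (2 * z.re) := by
    have h : ((‖d - z‖ ^ 2 : ℝ) : ℂ) = ((2 - d * (2 * z.re) : ℝ) : ℂ) := by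
      have hd' : (d : ℂ) ^ 2 = 1 := by exact_mod_cast hd
      rw [Complex.ofReal_sub, Complex.ofReal_mul, ← Complex.add_conj, Complex.ofReal_pow,
        ← Complex.mul_conj', map_sub, Complex.conj_ofReal, Complex.ofReal_ofNat]
      linear_combination hd' + hconj
    exact_mod_cast h
  have hquad : z ^ 2 - s * z + 1 = z * (2 * z.re - s : ℝ) := by
    rw [Complex.ofReal_sub, ← Complex.add_conj]
    linear_combination -hconj
  have hnorm : ‖z ^ 2 - s * z + 1‖ = |d * s - d * (2 * z.re)| := by
    have hd1 : |d| = 1 := by rw [← abs_one, ← sq_eq_sq_iff_abs_eq_abs, hd, one_pow]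
    rw [hquad, norm_mul, hz, one_mul, Complex.norm_real, Real.norm_eq_abs, ← mul_sub, abs_mul, hd1,
      one_mul, abs_sub_comm]
  rw [hnorm]
  linarith [two_mul_le_add_sq ‖d - z‖ 1, le_abs_self (d * s - d * (2 * z.re))]

theorem two_mul_norm_one_sub_sq_le {z : ℂ} (hz : ‖z‖ = 1) {s : ℝ} (hs : 1 ≤ s ^ 2) :
    2 * ‖1 - z ^ 2‖ ≤ ‖z ^ 2 - s * z - 1‖ ^ 2 := by
  have hconj := mul_conj_eq_one_of_norm_eq_one hz
  have hsub : 1 - z ^ 2 = -(z * ((2 * z.im : ℝ) * Complex.I)) := by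
    rw [← Complex.sub_conj]
    linear_combination -hconj
  have hquad : z ^ 2 - s * z - 1 = z * ((-s : ℝ) + (2 * z.im : ℝ) * Complex.I) := by
    rw [← Complex.sub_conj, Complex.ofReal_neg]
    linear_combination hconj
  have hnorm : ‖1 - z ^ 2‖ = |2 * z.im| := by
    rw [hsub, norm_neg, norm_mul, hz, one_mul, norm_mul, Complex.norm_I, mul_one,
      Complex.norm_real, Real.norm_eq_abs]
  have hnorm_sq : ‖z ^ 2 - s * z - 1‖ ^ 2 = s ^ 2 + (2 * z.im) ^ 2 := by
    rw [hquad, norm_mul, hz, one_mul, Complex.sq_norm, Complex.normSq_add_mul_I, neg_sq]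
  rw [hnorm, hnorm_sq, ← sq_abs (2 * z.im)]
  linarith [two_mul_le_add_sq |2 * z.im| 1]

theorem two_pow_totient_le_prod_primitiveRoots {n : ℕ} (hn : n ≠ 0) {g h : ℂ → ℝ}
    (hg : ∀ ζ, 0 ≤ g ζ) (hprod : 1 ≤ ∏ ζ ∈ primitiveRoots n ℂ, g ζ)
    (hgh : ∀ ζ, ‖ζ‖ = 1 → 2 * g ζ ≤ h ζ) :
    2 ^ n.totient ≤ ∏ ζ ∈ primitiveRoots n ℂ, h ζ := by
  have hcard := (Complex.isPrimitiveRoot_exp n hn).card_primitiveRoots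
  calc (2 : ℝ) ^ n.totient ≤ 2 ^ n.totient * ∏ ζ ∈ primitiveRoots n ℂ, g ζ :=
        le_mul_of_one_le_right (by positivity) hprod
    _ = ∏ ζ ∈ primitiveRoots n ℂ, 2 * g ζ := by
        rw [Finset.prod_mul_distrib, Finset.prod_const, hcard]
    _ ≤ ∏ ζ ∈ primitiveRoots n ℂ, h ζ :=
        Finset.prod_le_prod (fun ζ _ => mul_nonneg two_pos.le (hg ζ)) fun ζ hζ =>
          hgh ζ ((isPrimitiveRoot_of_mem_primitiveRoots hζ).norm'_eq_one hn)

theorem two_pow_totient_le_prod_norm_add_one {n : ℕ} (hn : 3 ≤ n) {s : ℤ} (hs : 3 ≤ |s|) :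
    2 ^ n.totient ≤ ∏ ζ ∈ primitiveRoots n ℂ, ‖ζ ^ 2 - s * ζ + 1‖ := by
  have hsign : s.sign ^ 2 = 1 := by
    rw [sq, ← Int.sign_mul, Int.sign_eq_one_iff_pos]
    exact mul_self_pos.mpr (by rintro rfl; norm_num at hs)
  refine two_pow_totient_le_prod_primitiveRoots (by omega) (fun _ => norm_nonneg _)
    (one_le_prod_norm_sub_primitiveRoots hn hsign) fun ζ hζ => ?_
  have hmul : 3 ≤ (s.sign : ℝ) * (s : ℝ) := by
    rw [← Int.sign_mul_self_eq_abs] at hs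
    exact_mod_cast hs
  simpa using two_mul_norm_sub_le hζ (d := s.sign) (by exact_mod_cast hsign) hmul

theorem two_pow_totient_le_prod_norm_sub_one_sq {n : ℕ} (hn : 3 ≤ n) {s : ℤ} (hs : s ≠ 0) :
    2 ^ n.totient ≤ ∏ ζ ∈ primitiveRoots n ℂ, ‖ζ ^ 2 - s * ζ - 1‖ ^ 2 := by
  refine two_pow_totient_le_prod_primitiveRoots (g := fun ζ => ‖1 - ζ ^ 2‖) (by omega)
    (fun _ => norm_nonneg _) ?_ fun ζ hζ => ?_
  · have hfactor (ζ : ℂ) : ‖1 - ζ ^ 2‖ = ‖((1 : ℤ) : ℂ) - ζ‖ * ‖((-1 : ℤ) : ℂ) - ζ‖ := by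
      rw [← norm_mul, ← norm_neg]
      congr 1
      push_cast
      ring
    simp only [hfactor, Finset.prod_mul_distrib]
    exact one_le_mul_of_one_le_of_one_le (one_le_prod_norm_sub_primitiveRoots hn (one_pow 2))
      (one_le_prod_norm_sub_primitiveRoots hn neg_one_sq)
  · have hs' : 1 ≤ (s : ℝ) ^ 2 := by
      exact_mod_cast Int.add_one_le_of_lt (sq_pos_of_ne_zero hs)
    simpa using two_mul_norm_one_sub_sq_le hζ hs'

/-- `N` is a quadratic norm with conjugation `τ`: an abstract form of the norm to `ℤ` of a ring of
integers in a quadratic field, where `τ` is the nontrivial automorphism. -/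
def IsQuadraticNorm {R : Type*} [CommRing R] (N : R →* ℤ) (τ : R →+* R) : Prop :=
  ∀ x, (N x : R) = x * τ x

namespace IsQuadraticNorm

universe u

variable {R : Type u} [CommRing R] {N : R →* ℤ} {τ : R →+* R} {A : Type*} [CommRing A] {p : ℕ}

theorem intCast_map (hN : IsQuadraticNorm N τ) (f : R →+* A) (x : R) :
    (N x : A) = f x * f (τ x) := by
  rw [← map_mul, ← hN, map_intCast]

theorem exists_trace (hN : IsQuadraticNorm N τ) (α : R) : ∃ t : ℤ, (t : R) = α + τ α := by
  refine ⟨N (1 + α) - 1 - N α, ?_⟩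
  push_cast
  rw [hN, hN, map_add, map_one]
  ring

theorem dvd_of_map_eq_zero [CharP A p] (hN : IsQuadraticNorm N τ) (f : R →+* A) {x : R}
    (hx : f x = 0) : (p : ℤ) ∣ N x := by
  rw [← CharP.intCast_eq_zero_iff A p, hN.intCast_map f, hx, zero_mul]

/-- The Frobenius permutes the roots `f α` and `f (τ α)` of a quadratic polynomial over `𝔽_p`. -/
theorem map_pow_prime_sq [IsDomain A] [Fact p.Prime] [CharP A p] (hN : IsQuadraticNorm N τ)
    (f : R →+* A) (α : R) : f α ^ p ^ 2 = f α := by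
  obtain ⟨t, ht⟩ := hN.exists_trace α
  have hsum : (t : A) = f α + f (τ α) := by rw [← map_add, ← ht, map_intCast]
  have hmul : (N α : A) = f α * f (τ α) := hN.intCast_map f α
  have hroot : (f α ^ p - f α) * (f α ^ p - f (τ α)) = 0 := by
    have h : frobenius A p (f α ^ 2 - t * f α + N α) = 0 := by
      rw [show f α ^ 2 - t * f α + N α = 0 by rw [hsum, hmul]; ring, map_zero]
    rw [map_add, map_sub, map_mul, map_pow, map_intCast, map_intCast, frobenius_def] at h
    linear_combination h + f α ^ p * hsum - hmul
  rw [sq, pow_mul]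
  rcases mul_eq_zero.mp hroot with h | h <;> rw [sub_eq_zero] at h
  · rw [h, h]
  · have hconj : f (τ α) = t - f α := by rw [hsum]; ring
    rw [h, ← frobenius_def, hconj, map_sub, map_intCast, frobenius_def, h, hsum]
    ring

theorem dvd_prime_sq_sub_one_of_isPrimitiveRoot [IsDomain A] [Fact p.Prime] [CharP A p]
    (hN : IsQuadraticNorm N τ) (f : R →+* A) {α : R} {r : ℕ} (hr : r ≠ 0)
    (hroot : IsPrimitiveRoot (f α) r) : r ∣ p ^ 2 - 1 := by
  refine hroot.dvd_of_pow_eq_one _ (mul_left_cancel₀ (hroot.ne_zero hr) ?_)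
  rw [mul_one, mul_pow_sub_one (pow_ne_zero 2 (Fact.out : p.Prime).ne_zero), hN.map_pow_prime_sq f]

theorem map_pow_eq_of_dvd_norm_pow_sub_one [IsDomain A] [CharP A p] (hN : IsQuadraticNorm N τ)
    (f : R →+* A) {α : R} {m : ℕ} (h : (p : ℤ) ∣ N (α ^ m - 1)) :
    f α ^ m = 1 ∨ f α ^ m = (N α : A) ^ m := by
  rw [← CharP.intCast_eq_zero_iff A p, hN.intCast_map f] at h
  simp only [map_sub, map_pow, map_one] at h
  refine (mul_eq_zero.mp h).imp sub_eq_zero.mp fun h => ?_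
  rw [hN.intCast_map f, mul_pow, sub_eq_zero.mp h, mul_one]

theorem dvd_of_isPrimitiveRoot_of_dvd_norm_pow_sub_one [IsDomain A] [CharP A p]
    (hN : IsQuadraticNorm N τ) (f : R →+* A) {α : R} {r m : ℕ} (hr : IsPrimitiveRoot (f α) r)
    (hα : N α = 1 ∨ N α = -1 ∧ ¬ r ≡ 2 [MOD 4]) (hm : (p : ℤ) ∣ N (α ^ m - 1)) :
    r ∣ m := by
  rcases hN.map_pow_eq_of_dvd_norm_pow_sub_one f hm with h | h
  · exact hr.dvd_of_pow_eq_one m h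
  rcases hα with hα | ⟨hα, hmod⟩
  · exact hr.dvd_of_pow_eq_one m (by rw [h, hα, Int.cast_one, one_pow])
  · exact dvd_of_isPrimitiveRoot_of_pow_eq_neg_one_pow hr (by simpa [hα] using h) hmod

theorem sub_one_sq_eq (hN : IsQuadraticNorm N τ) {β : R} (hβ : N β = 1) :
    (β - 1) ^ 2 = -β * N (β - 1) := by
  have hmul : (1 : R) = β * τ β := by simpa [hβ] using hN β
  rw [hN, map_sub, map_one]
  linear_combination (1 - β) * hmul

theorem sq_dvd_sub_one_pow (hN : IsQuadraticNorm N τ) {β : R} (hβ : N β = 1)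
    (h : 5 ≤ p ∧ (p : ℤ) ∣ N (β - 1) ∨ 3 ≤ p ∧ (p : ℤ) ^ 2 ∣ N (β - 1)) :
    (p : R) ^ 2 ∣ (β - 1) ^ (p - 1) := by
  have hcast {m c : ℤ} (hm : m ∣ c) : (m : R) ∣ c := _root_.map_dvd (Int.castRingHom R) hm
  rcases h with ⟨hp, h⟩ | ⟨hp, h⟩
  · have hsq : (p : R) ∣ (β - 1) ^ 2 := by
      rw [hN.sub_one_sq_eq hβ]
      exact (by exact_mod_cast hcast h : (p : R) ∣ N (β - 1)).mul_left _
    calc (p : R) ^ 2 ∣ ((β - 1) ^ 2) ^ 2 := pow_dvd_pow_of_dvd hsq 2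
      _ = (β - 1) ^ 4 := by ring
      _ ∣ (β - 1) ^ (p - 1) := pow_dvd_pow _ (by omega)
  · calc (p : R) ^ 2 ∣ N (β - 1) := by exact_mod_cast hcast h
      _ ∣ (β - 1) ^ 2 := by rw [hN.sub_one_sq_eq hβ]; exact dvd_mul_left _ _
      _ ∣ (β - 1) ^ (p - 1) := pow_dvd_pow _ (by omega)

section CharZero

variable [CharZero R]

theorem apply_natCast (hN : IsQuadraticNorm N τ) (m : ℕ) : N (m : R) = (m : ℤ) ^ 2 := by
  have h := hN m
  rw [_root_.map_natCast τ, ← sq] at h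
  exact_mod_cast h

theorem exists_field_map_eq_zero (hN : IsQuadraticNorm N τ) (hp : p.Prime) {x : R}
    (h : (p : ℤ) ∣ N x) :
    ∃ (k : Type u) (_ : Field k) (_ : CharP k p) (f : R →+* k), f x = 0 := by
  have hunit : ¬ IsUnit (p : R) := fun hu => by
    have hu' := hu.map N
    rw [hN.apply_natCast, isUnit_pow_iff two_ne_zero] at hu'
    exact (Nat.prime_iff_prime_int.mp hp).not_isUnit hu'
  obtain ⟨M, hM, hpM⟩ := exists_max_ideal_of_mem_nonunits hunit
  let _ : Field (R ⧸ M) := Ideal.Quotient.field M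
  let π := Ideal.Quotient.mk M
  have hchar : CharP (R ⧸ M) p := ringChar.of_eq <| CharP.ringChar_of_prime_eq_zero hp <| by
    simpa using Ideal.Quotient.eq_zero_iff_mem.mpr hpM
  have hzero : π x * π (τ x) = 0 := by
    rw [← hN.intCast_map, CharP.intCast_eq_zero_iff _ p]
    exact h
  rcases mul_eq_zero.mp hzero with hx | hx
  · exact ⟨R ⧸ M, _, hchar, π, hx⟩
  · exact ⟨R ⧸ M, _, hchar, π.comp τ, hx⟩

theorem dvd_norm_geom_sum (hN : IsQuadraticNorm N τ) (hp : p.Prime) {β : R}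
    (h : (p : ℤ) ∣ N (β - 1)) : (p : ℤ) ∣ N (∑ i ∈ Finset.range p, β ^ i) := by
  obtain ⟨k, _, _, f, hf⟩ := hN.exists_field_map_eq_zero hp h
  have hβ : f β = 1 := by rwa [map_sub, map_one, sub_eq_zero] at hf
  exact hN.dvd_of_map_eq_zero f (by simp [hβ])

theorem pow_succ_dvd_norm_pow_sub_one (hN : IsQuadraticNorm N τ) (hp : p.Prime) {β : R}
    (h : (p : ℤ) ∣ N (β - 1)) (i : ℕ) : (p : ℤ) ^ (i + 1) ∣ N (β ^ p ^ i - 1) := by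
  induction i with
  | zero => simpa using h
  | succ i ih =>
    rw [pow_succ p i, pow_mul, ← mul_geom_sum, map_mul, pow_succ (p : ℤ)]
    exact mul_dvd_mul ih (hN.dvd_norm_geom_sum hp ((dvd_pow_self _ i.succ_ne_zero).trans ih))

theorem not_pow_three_dvd_norm_geom_sum_of_sq_dvd (hN : IsQuadraticNorm N τ) (hp : p.Prime)
    (hp2 : p ≠ 2) {β : R} (h : (p : R) ^ 2 ∣ (β - 1) ^ (p - 1)) :
    ¬ (p : ℤ) ^ 3 ∣ N (∑ i ∈ Finset.range p, β ^ i) := by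
  obtain ⟨w, z, hsum⟩ := exists_geom_sum_eq_prime_mul hp hp2 h
  rw [hsum, map_mul, hN.apply_natCast, pow_succ]
  intro hcube
  have hdvd : (p : ℤ) ∣ N (1 + (β - 1) * w + p * z) :=
    Int.dvd_of_mul_dvd_mul_left (by have := hp.pos; positivity) hcube
  obtain ⟨k, _, _, f, hf⟩ := hN.exists_field_map_eq_zero hp hdvd
  have hpk : f p = 0 := by rw [_root_.map_natCast, CharP.cast_eq_zero]
  have hβ : f (β - 1) = 0 := by
    have := map_dvd f h
    rw [map_pow, hpk, zero_pow two_ne_zero, zero_dvd_iff, map_pow] at this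
    exact (pow_eq_zero_iff (Nat.sub_pos_of_lt hp.one_lt).ne').mp this
  simp [hpk, hβ] at hf

theorem not_pow_three_dvd_norm_geom_sum_of_odd (hN : IsQuadraticNorm N τ) (hp : p.Prime)
    (hp2 : p ≠ 2) {β : R} (hβ : N β ^ 2 = 1) (h : (p : ℤ) ∣ N (β - 1))
    (h' : 5 ≤ p ∨ (p : ℤ) ^ 2 ∣ N (β - 1)) :
    ¬ (p : ℤ) ^ 3 ∣ N (∑ i ∈ Finset.range p, β ^ i) := by
  have hp3 : 3 ≤ p := hp.two_le.lt_of_ne' hp2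
  have hdvd : N (β - 1) ∣ N (β ^ 2 - 1) := map_dvd N (sub_one_dvd_pow_sub_one _ _)
  have hsq : (p : R) ^ 2 ∣ (β ^ 2 - 1) ^ (p - 1) :=
    hN.sq_dvd_sub_one_pow (by rw [map_pow, hβ]) <| h'.imp (fun h5 => ⟨h5, h.trans hdvd⟩)
      fun h2 => ⟨hp3, h2.trans hdvd⟩
  exact fun hcube => hN.not_pow_three_dvd_norm_geom_sum_of_sq_dvd hp hp2 hsq
    (hcube.trans (map_dvd N (geom_sum_dvd_geom_sum_sq hp hp2 β)))

theorem not_eight_dvd_norm_one_add (hN : IsQuadraticNorm N τ) {β : R} (hβ : N β = 1)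
    (h : 8 ∣ N (β - 1)) : ¬ 8 ∣ N (1 + β) := by
  have hparallelogram : N (1 + β) = 4 - N (β - 1) := by
    have hmul : (1 : R) = β * τ β := by simpa [hβ] using hN β
    have hcast : ((N (1 + β) : ℤ) : R) = ((4 - N (β - 1) : ℤ) : R) := by
      rw [Int.cast_sub, hN, hN, map_add, map_sub, map_one, Int.cast_ofNat]
      linear_combination (-2) * hmul
    exact_mod_cast hcast
  omega

theorem not_pow_three_dvd_norm_geom_sum (hN : IsQuadraticNorm N τ) (hp : p.Prime) {β : R}
    (hβ : N β = 1 ∨ N β = -1 ∧ p ≠ 2) (h : (p : ℤ) ∣ N (β - 1))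
    (h' : 5 ≤ p ∨ (p : ℤ) ^ 3 ∣ N (β - 1)) :
    ¬ (p : ℤ) ^ 3 ∣ N (∑ i ∈ Finset.range p, β ^ i) := by
  rcases eq_or_ne p 2 with rfl | hp2
  · have hβ1 : N β = 1 := hβ.resolve_right fun h => h.2 rfl
    have h8 : (8 : ℤ) ∣ N (β - 1) := by simpa using h'
    simpa [Finset.sum_range_succ] using hN.not_eight_dvd_norm_one_add hβ1 h8
  · refine hN.not_pow_three_dvd_norm_geom_sum_of_odd hp hp2 ?_ h
      (h'.imp_right (pow_dvd_pow _ (by norm_num : 2 ≤ 3)).trans)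
    rcases hβ with hβ | ⟨hβ, -⟩ <;> simp [hβ]

theorem exists_isPrimitiveRoot_of_dvd_norm_cyclotomic (hN : IsQuadraticNorm N τ) (hp : p.Prime)
    {n : ℕ} (hn : n ≠ 0) {α : R} (h : (p : ℤ) ∣ N ((cyclotomic n R).eval α)) :
    ∃ (k : Type u) (_ : Field k) (_ : CharP k p) (f : R →+* k) (j r : ℕ),
      n = p ^ j * r ∧ ¬ p ∣ r ∧ IsPrimitiveRoot (f α) r := by
  have := Fact.mk hp
  obtain ⟨k, _, _, f, hf⟩ := hN.exists_field_map_eq_zero hp h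
  rw [← eval₂_hom, ← eval_map, map_cyclotomic] at hf
  exact ⟨k, _, inferInstance, f, exists_isPrimitiveRoot_of_isRoot_cyclotomic (p := p) hn hf⟩

theorem dvd_of_dvd_norm_cyclotomic_of_dvd_norm_pow_sub_one (hN : IsQuadraticNorm N τ)
    (hp : p.Prime) {n m : ℕ} (hm : m ≠ 0) (hmn : m < n) {α : R}
    (hα : N α = 1 ∨ N α = -1 ∧ ¬ n ≡ 2 [MOD 4]) (h : (p : ℤ) ∣ N ((cyclotomic n R).eval α))
    (hpm : (p : ℤ) ∣ N (α ^ m - 1)) : p ∣ n := by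
  obtain ⟨k, _, _, f, j, r, rfl, -, hroot⟩ :=
    hN.exists_isPrimitiveRoot_of_dvd_norm_cyclotomic hp (Nat.ne_zero_of_lt hmn) h
  rcases eq_or_ne j 0 with rfl | hj
  · rw [pow_zero, one_mul] at hα hmn
    have hrm : r ∣ m := hN.dvd_of_isPrimitiveRoot_of_dvd_norm_pow_sub_one f hroot hα hpm
    exact absurd (Nat.le_of_dvd (Nat.pos_of_ne_zero hm) hrm) hmn.not_ge
  · exact (dvd_pow_self p hj).mul_right r

theorem dvd_norm_pow_div_sub_one (hN : IsQuadraticNorm N τ) (hp : p.Prime) {n : ℕ} (hn : 72 < n)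
    (hpn : p ∣ n) {α : R} (h : (p : ℤ) ∣ N ((cyclotomic n R).eval α)) :
    (p : ℤ) ∣ N (α ^ (n / p) - 1) ∧ (5 ≤ p ∨ (p : ℤ) ^ 3 ∣ N (α ^ (n / p) - 1)) := by
  have := Fact.mk hp
  obtain ⟨k, _, _, f, j, r, hnr, hpr, hroot⟩ :=
    hN.exists_isPrimitiveRoot_of_dvd_norm_cyclotomic hp (Nat.ne_zero_of_lt hn) h
  obtain ⟨i, rfl⟩ : ∃ i, j = i + 1 := Nat.exists_eq_succ_of_ne_zero <| by
    rintro rfl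
    exact hpr (by simpa [hnr] using hpn)
  have hpow : (p : ℤ) ^ (i + 1) ∣ N (α ^ (n / p) - 1) := by
    have hr : (p : ℤ) ∣ N (α ^ r - 1) := hN.dvd_of_map_eq_zero f (by simp [hroot.pow_eq_one])
    rw [show n / p = r * p ^ i from Nat.div_eq_of_eq_mul_left hp.pos (by rw [hnr]; ring), pow_mul]
    exact hN.pow_succ_dvd_norm_pow_sub_one hp hr i
  refine ⟨(dvd_pow_self _ i.succ_ne_zero).trans hpow, ?_⟩
  by_contra! hsmall
  have hp3 : p ≤ 3 := by
    have hp4 : p ≠ 4 := by rintro rfl; norm_num at hp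
    omega
  have hi : i + 1 ≤ 2 := by
    by_contra! hi
    exact hsmall.2 ((pow_dvd_pow _ hi).trans hpow)
  have hrp : r ∣ p ^ 2 - 1 := hN.dvd_prime_sq_sub_one_of_isPrimitiveRoot f
    (by rintro rfl; simp at hpr) hroot
  have hn72 : n ≤ 72 :=
    calc n = p ^ (i + 1) * r := hnr
      _ ≤ p ^ 2 * (p ^ 2 - 1) := Nat.mul_le_mul (Nat.pow_le_pow_right hp.pos hi)
        (Nat.le_of_dvd (Nat.sub_pos_of_lt (Nat.one_lt_pow two_ne_zero hp.one_lt)) hrp)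
      _ ≤ 3 ^ 2 * (3 ^ 2 - 1) := by gcongr
  omega

theorem not_pow_three_dvd_norm_cyclotomic (hN : IsQuadraticNorm N τ) (hp : p.Prime) {n : ℕ}
    (hn : 72 < n) (hpn : p ∣ n) {α : R} (hα : N α = 1 ∨ N α = -1 ∧ ¬ n ≡ 2 [MOD 4]) :
    ¬ (p : ℤ) ^ 3 ∣ N ((cyclotomic n R).eval α) := by
  intro hcube
  obtain ⟨hdvd, hlarge⟩ :=
    hN.dvd_norm_pow_div_sub_one hp hn hpn ((dvd_pow_self _ three_ne_zero).trans hcube)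
  have hβ : N (α ^ (n / p)) = 1 ∨ N (α ^ (n / p)) = -1 ∧ p ≠ 2 := by
    rw [map_pow]
    exact pow_div_eq_one_or_eq_neg_one hα hpn
  exact hN.not_pow_three_dvd_norm_geom_sum hp hβ hdvd hlarge <| hcube.trans <|
    map_dvd N (cyclotomic_eval_dvd_geom_sum (Nat.ne_zero_of_lt hn) hp.one_lt hpn α)

theorem norm_cyclotomic_dvd_sq (hN : IsQuadraticNorm N τ) {n : ℕ} (hn : 72 < n) {α : R}
    (hα : N α = 1 ∨ N α = -1 ∧ ¬ n ≡ 2 [MOD 4])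
    (hprim : ¬ HasPrimitivePrimeDivisor (fun m => N (α ^ m - 1)) n) :
    N ((cyclotomic n R).eval α) ∣ (n : ℤ) ^ 2 := by
  refine dvd_sq_of_forall_prime_dvd fun p hp hpF => ?_
  obtain ⟨m, hm, hmn, hpm⟩ : ∃ m, 1 ≤ m ∧ m < n ∧ (p : ℤ) ∣ N (α ^ m - 1) := by
    by_contra! hno
    exact hprim ⟨p, hp, hpF.trans (map_dvd N (cyclotomic_eval_dvd_pow_sub_one n α)),
      fun m hm hmn _ => hno m hm hmn⟩
  have hpn : p ∣ n := hN.dvd_of_dvd_norm_cyclotomic_of_dvd_norm_pow_sub_one hp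
    (Nat.one_le_iff_ne_zero.mp hm) hmn hα hpF hpm
  exact ⟨hpn, hN.not_pow_three_dvd_norm_cyclotomic hp hn hpn hα⟩

end CharZero

theorem abs_norm_cyclotomic_eq_prod (hN : IsQuadraticNorm N τ) (ψ : R →+* ℂ) {n : ℕ} (hn : n ≠ 0)
    {α : R} {t : ℤ} (ht : (t : R) = α + τ α) :
    |(N ((cyclotomic n R).eval α) : ℝ)| =
      ∏ ζ ∈ primitiveRoots n ℂ, ‖ζ ^ 2 - t * ζ + N α‖ := by
  have heval (x : R) : ψ ((cyclotomic n R).eval x) = ∏ ζ ∈ primitiveRoots n ℂ, (ψ x - ζ) := by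
    rw [← eval_cyclotomic_eq_prod_sub_primitiveRoots hn, ← eval₂_hom, ← eval_map, map_cyclotomic]
  have hτ : τ ((cyclotomic n R).eval α) = (cyclotomic n R).eval (τ α) := by
    rw [← eval₂_hom, ← eval_map, map_cyclotomic]
  have hsum : (t : ℂ) = ψ α + ψ (τ α) := by rw [← map_add, ← ht, map_intCast]
  rw [← Complex.norm_intCast, hN.intCast_map ψ, hτ, heval, heval, ← Finset.prod_mul_distrib,
    norm_prod]
  refine Finset.prod_congr rfl fun ζ _ => congrArg norm ?_
  rw [hN.intCast_map ψ, hsum]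
  ring

theorem three_le_abs_trace (hN : IsQuadraticNorm N τ) (φ : R →+* ℝ) {α : R} {t : ℤ}
    (ht : (t : R) = α + τ α) (hα : N α = 1) (hsq : φ α ^ 2 ≠ 1) : 3 ≤ |t| := by
  have hsum : (t : ℝ) = φ α + φ (τ α) := by rw [← map_add, ← ht, map_intCast]
  have hmul : 1 = φ α * φ (τ α) := by simpa [hα] using hN.intCast_map φ α
  have hne : φ α - φ (τ α) ≠ 0 := fun h =>
    hsq (by rw [hmul, ← sub_eq_zero.mp h, sq])
  have hdisc : (2 : ℝ) ^ 2 < (t : ℝ) ^ 2 := by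
    have hdisc_eq : (t : ℝ) ^ 2 - 2 ^ 2 = (φ α - φ (τ α)) ^ 2 := by
      rw [hsum]
      linear_combination (-4) * hmul
    have : 0 < (φ α - φ (τ α)) ^ 2 := by positivity
    linarith
  have hlt : |(2 : ℤ)| < |t| := sq_lt_sq.mp (by exact_mod_cast hdisc)
  rwa [abs_two] at hlt

theorem trace_ne_zero (hN : IsQuadraticNorm N τ) (φ : R →+* ℝ) {α : R} {t : ℤ}
    (ht : (t : R) = α + τ α) (hα : N α = -1) (hsq : φ α ^ 2 ≠ 1) : t ≠ 0 := by
  rintro rfl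
  have hsum : (0 : ℝ) = φ α + φ (τ α) := by rw [← map_add, ← ht, Int.cast_zero, map_zero]
  have hmul : -1 = φ α * φ (τ α) := by simpa [hα] using hN.intCast_map φ α
  exact hsq (by linear_combination hmul - φ α * hsum)

theorem two_pow_totient_le_norm_cyclotomic_sq (hN : IsQuadraticNorm N τ) (φ : R →+* ℝ) {n : ℕ}
    (hn : 3 ≤ n) {α : R} (hsq : φ α ^ 2 ≠ 1) (hα : N α = 1 ∨ N α = -1) :
    2 ^ n.totient ≤ N ((cyclotomic n R).eval α) ^ 2 := by
  obtain ⟨t, ht⟩ := hN.exists_trace α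
  have hprod := hN.abs_norm_cyclotomic_eq_prod (Complex.ofRealHom.comp φ)
    (by omega : n ≠ 0) ht
  suffices (2 : ℝ) ^ n.totient ≤ |(N ((cyclotomic n R).eval α) : ℝ)| ^ 2 by
    rw [sq_abs] at this
    exact_mod_cast this
  rw [hprod]
  rcases hα with hα | hα
  · have hbound := two_pow_totient_le_prod_norm_add_one hn (hN.three_le_abs_trace φ ht hα hsq)
    have hone : (1 : ℝ) ≤ 2 ^ n.totient := one_le_pow₀ one_le_two
    rw [hα, Int.cast_one]
    exact hbound.trans (le_self_pow₀ (hone.trans hbound) two_ne_zero)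
  · rw [hα, ← Finset.prod_pow]
    simpa [← sub_eq_add_neg] using
      two_pow_totient_le_prod_norm_sub_one_sq hn (hN.trace_ne_zero φ ht hα hsq)

theorem hasPrimitivePrimeDivisor_norm_pow_sub_one (hN : IsQuadraticNorm N τ) (φ : R →+* ℝ) {n : ℕ}
    (hn : 8192 < n) {α : R} (hsq : φ α ^ 2 ≠ 1) (hα : N α = 1 ∨ N α = -1 ∧ ¬ n ≡ 2 [MOD 4]) :
    HasPrimitivePrimeDivisor (fun k => N (α ^ k - 1)) n := by
  have : CharZero R := φ.charZero
  by_contra hprim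
  have hdvd : N ((cyclotomic n R).eval α) ∣ (n : ℤ) ^ 2 :=
    hN.norm_cyclotomic_dvd_sq (by omega) hα hprim
  have hupper : N ((cyclotomic n R).eval α) ^ 2 ≤ (n : ℤ) ^ 4 :=
    Int.le_of_dvd (by positivity) (by simpa [← pow_mul] using pow_dvd_pow_of_dvd hdvd 2)
  have hlower : (2 : ℤ) ^ n.totient ≤ N ((cyclotomic n R).eval α) ^ 2 :=
    hN.two_pow_totient_le_norm_cyclotomic_sq φ (by omega) hsq (hα.imp_right And.left)
  exact (pow_four_lt_two_pow_totient hn).not_ge (by exact_mod_cast hlower.trans hupper)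

end IsQuadraticNorm

section RealQuadraticField

variable {K : Type*} [Field K] [NumberField K]

theorem exists_isQuadraticNorm (hK : Module.finrank ℚ K = 2) :
    ∃ τ : 𝓞 K →+* 𝓞 K, IsQuadraticNorm (Algebra.norm ℤ) τ := by
  classical
  have : Algebra.IsQuadraticExtension ℚ K := ⟨hK⟩
  have hcard : Fintype.card Gal(K/ℚ) = 2 := by
    rw [← Nat.card_eq_fintype_card, IsGalois.card_aut_eq_finrank, hK]
  obtain ⟨σ, hσ⟩ := Fintype.exists_ne_of_one_lt_card (by omega) (1 : Gal(K/ℚ))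
  have huniv : (Finset.univ : Finset Gal(K/ℚ)) = {1, σ} := by
    rw [eq_comm, ← Finset.card_eq_iff_eq_univ, Finset.card_pair hσ.symm, hcard]
  refine ⟨NumberField.RingOfIntegers.mapRingHom (σ : K →+* K), fun x => ?_⟩
  have hnorm := Algebra.norm_eq_prod_automorphisms ℚ (x : K)
  rw [huniv, Finset.prod_pair hσ.symm, ← Algebra.coe_norm_int] at hnorm
  exact NumberField.RingOfIntegers.ext (by simpa using hnorm)

theorem hasPrimitivePrimeDivisor_lehmerPierce (hK : IsRealQuadraticField K) {α : (𝓞 K)ˣ}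
    (h_one : α ≠ 1) (h_neg_one : α ≠ -1) {n : ℕ} (hn : 8192 < n)
    (hα : Algebra.norm ℚ ((α : 𝓞 K) : K) = 1 ∨
      Algebra.norm ℚ ((α : 𝓞 K) : K) = -1 ∧ ¬ n ≡ 2 [MOD 4]) :
    HasPrimitivePrimeDivisor (lehmerPierce (α : 𝓞 K)) n := by
  obtain ⟨hfin, ⟨f⟩⟩ := hK
  obtain ⟨τ, hτ⟩ := exists_isQuadraticNorm hfin
  let φ : 𝓞 K →+* ℝ := f.comp (algebraMap (𝓞 K) K)
  have hφ : Function.Injective φ :=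
    f.injective.comp NumberField.RingOfIntegers.coe_injective
  have hsq : φ α ^ 2 ≠ 1 := by
    rw [← map_pow, ← map_one φ, hφ.ne_iff, Ne, sq_eq_one_iff, not_or]
    exact ⟨fun h => h_one (Units.ext h), fun h => h_neg_one (Units.ext h)⟩
  rw [← Algebra.coe_norm_int] at hα
  exact hτ.hasPrimitivePrimeDivisor_norm_pow_sub_one φ hn hsq (by exact_mod_cast hα)

end RealQuadraticField

theorem zsigmondyBound_le {a : ℕ → ℤ} {C : ℕ} (h : ∀ n, C < n → HasPrimitivePrimeDivisor a n) :
    zsigmondyBound a ≤ C := by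
  have hle : ∀ n ∈ nonPrimitiveIndices a, n ≤ C := fun n hn => by
    by_contra! hlt
    exact hn.2 (h n hlt)
  have hfin : (nonPrimitiveIndices a).Finite := (Set.finite_Iic C).subset hle
  rw [zsigmondyBound, dif_pos hfin]
  exact_mod_cast Finset.sup_le fun n hn => hle n (hfin.mem_toFinset.mp hn)

theorem corollary1p3 :
    (∃ C₁ : ℕ, 0 < C₁ ∧
      ∀ (K : Type*) [Field K] [NumberField K], IsRealQuadraticField K →
        ∀ α : (𝓞 K)ˣ, α ≠ 1 → α ≠ -1 → Algebra.norm ℚ ((α : 𝓞 K) : K) = 1 →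
          zsigmondyBound (lehmerPierce (α : 𝓞 K)) ≤ (C₁ : ℕ∞)) ∧
    (∃ C₂ : ℕ, 0 < C₂ ∧
      ∀ (K : Type*) [Field K] [NumberField K], IsRealQuadraticField K →
        ∀ α : (𝓞 K)ˣ, α ≠ 1 → α ≠ -1 → Algebra.norm ℚ ((α : 𝓞 K) : K) = -1 →
          ∀ n : ℕ, C₂ < n → ¬ n ≡ 2 [MOD 4] →
            HasPrimitivePrimeDivisor (lehmerPierce (α : 𝓞 K)) n) :=
  ⟨⟨8192, by norm_num, fun _ _ _ hK _ h_one h_neg_one hα => zsigmondyBound_le fun _ hn =>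
      hasPrimitivePrimeDivisor_lehmerPierce hK h_one h_neg_one hn (Or.inl hα)⟩,
    ⟨8192, by norm_num, fun _ _ _ hK _ h_one h_neg_one hα _ hn hmod =>
      hasPrimitivePrimeDivisor_lehmerPierce hK h_one h_neg_one hn (Or.inr ⟨hα, hmod⟩)⟩⟩
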